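/- For $x_1,\dots,x_n\in[0,1]^d$ let the dispersion be $$\operatorname{disp}(x_1,\dots,x_n)=\sup\{\lambda_d(B) : B=I_1\times\dots\times I_d,\ I_k\subseteq[0,1]\text{ intervals},\ B\cap\{x_1,\dots,x_n\}=\emptyset\},$$ where $\lambda_d$ is the $d$-dimensional Lebesgue measure. Let $X_1,X_2,\dots$ be independent random variables, each uniformly distributed in $[0,1]^d$, and for $\varepsilon\in(0,1)$ and an integer $d\ge 1$ let $$N(\varepsilon,d)=\min\{n\in\mathbb N,\ n\ge 1 : \mathbb E\operatorname{disp}(X_1,\dots,X_n)\le\varepsilon\}.$$ This number depends only on $\varepsilon$ and $d$, not on the choice of the sequence or of the probability space. For all $\varepsilon\in\bigl(0,\tfrac1{9\mathrm e}\bigr)$ and all integers $d\ge1$ the minimum exists and $$\max\Bigl\{\frac1{9\varepsilon}\log\Bigl(\frac1{9\varepsilon}\Bigr),\ \frac{d}{2\mathrm e\,\varepsilon}\Bigr\}\ \le\ N(\varepsilon,d)\ \le\ \Bigl\lceil 9(1+\mathrm e^{-1})\,\frac d\varepsilon\,\log\Bigl(\frac{9(\mathrm e+1)}{\varepsilon}\Bigr)\Bigr\rceil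 .$$ In particular, for every fixed $\varepsilon\in\bigl(0,\tfrac1{9\mathrm e}\bigr)$, $N(\varepsilon,d)$ grows linearly in the dimension: $N(\varepsilon,d)=\Theta(d)$ as $d\to\infty$. -/

import Mathlib

open MeasureTheory ProbabilityTheory Asymptotics

/-- `B` is an axis-parallel box `I₁ × ⋯ × I_d` with intervals `I_k ⊆ [0,1]`; the intervals may be
open, closed, half-open or degenerate (order-connected subsets of `ℝ` are exactly the intervals). -/
def IsUnitBox {d : ℕ} (B : Set (Fin d → ℝ)) : Prop :=
  ∃ I : Fin d → Set ℝ,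
    (∀ k, (I k).OrdConnected ∧ I k ⊆ Set.Icc 0 1) ∧ B = Set.univ.pi I

/-- The dispersion of `x₁, …, x_n`: the supremum of the volumes of the axis-parallel boxes in
`[0,1]^d` that contain none of the points. (The set of volumes contains `0` and is bounded
by `1`, so the real supremum is the true one.) -/
noncomputable def dispersion {n d : ℕ} (x : Fin n → Fin d → ℝ) : ℝ :=
  sSup {v : ℝ | ∃ B : Set (Fin d → ℝ), IsUnitBox B ∧ (∀ i, x i ∉ B) ∧ v = volume.real B}

/-- The uniform distribution on the cube `[0,1]^d`. -/
noncomputable def uniformCube (d : ℕ) : Measure (Fin d → ℝ) :=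
  volume.restrict (Set.Icc 0 1)

/-- The expected dispersion of `n` independent points that are uniform in `[0,1]^d`,
as the integral of the dispersion against the joint law of the points. -/
noncomputable def expectedDispersion (n d : ℕ) : ℝ :=
  ∫ x : Fin n → Fin d → ℝ, dispersion x ∂(Measure.pi fun _ => uniformCube d)

/-- The inverse `N(ε,d)` of the expected dispersion: the least `n ≥ 1` for which the expected
dispersion of `n` points is at most `ε`. -/
noncomputable def invExpectedDispersion (ε : ℝ) (d : ℕ) : ℕ :=
  sInf {n : ℕ | 1 ≤ n ∧ expectedDispersion n d ≤ ε}

/-! The two lower bounds come from explicit empty boxes, the upper bound from a union bound over a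
small family of grid boxes.

Lower bound linear in `d`: start from the cube `[0,s)^d` with `s ^ d = v` and, for each point,
shrink the side along its largest coordinate by the factor `min (‖x‖ / s) 1`. The result is empty
and its volume is a product over the independent points, so the expectation factors; a layer-cake
estimate gives `mul_one_sub_pow_le_expectedDispersion`, and `v` is then optimised.

Lower bound with the logarithm: cut the cube into `m` slabs of volume `1 / m`. A second moment
argument (`mul_div_one_add_le_integral_of_empty_cell`) shows that some slab is likely to stay empty
while `n < x * log x`, with `m` close to `x = 1 / (9ε)`.

Upper bound: a box of volume above `t` contains a grid box of mesh `h`, of order `ε / d`, with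
nearly the same volume. A full grid would have about `(d/ε)^(2d)` boxes and cost a factor `log d`.
But the sides of a large box have total defect at most `1 / t`, so only grid indices of bounded sum
occur, and there are at most `(C/ε²)^(2d)` of these (`card_tuplesWithSumLE_le`). Each is empty with
probability at most `exp (-n ε / 2)`, and `n` of order `(d/ε) log (1/ε)` suffices. -/

/-! ### Volumes of boxes and their approximation from inside. -/

theorem uniformCube_apply_of_subset {d : ℕ} {s : Set (Fin d → ℝ)} (hs : s ⊆ Set.Icc 0 1) :
    uniformCube d s = volume s :=
  Measure.restrict_eq_self _ hs

instance isProbabilityMeasure_uniformCube (d : ℕ) : IsProbabilityMeasure (uniformCube d) := by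
  refine ⟨?_⟩
  rw [uniformCube, Measure.restrict_apply_univ, Real.volume_Icc_pi]
  simp

theorem IsUnitBox.subset_Icc {d : ℕ} {B : Set (Fin d → ℝ)} (hB : IsUnitBox B) :
    B ⊆ Set.Icc 0 1 := by
  obtain ⟨I, hI, rfl⟩ := hB
  intro x hx
  exact ⟨fun k => ((hI k).2 (hx k trivial)).1, fun k => ((hI k).2 (hx k trivial)).2⟩

theorem IsUnitBox.volume_real_le_one {d : ℕ} {B : Set (Fin d → ℝ)} (hB : IsUnitBox B) :
    volume.real B ≤ 1 := by
  rw [measureReal_def, ← uniformCube_apply_of_subset hB.subset_Icc]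
  exact measureReal_le_one

/-- A box of positive volume has the volume of the open box spanned by its endpoints. -/
theorem IsUnitBox.exists_endpoints {d : ℕ} {B : Set (Fin d → ℝ)} (hB : IsUnitBox B)
    (hpos : 0 < volume.real B) :
    ∃ a b : Fin d → ℝ, (∀ j, 0 ≤ a j ∧ a j < b j ∧ b j ≤ 1) ∧
      (Set.univ.pi fun j => Set.Ioo (a j) (b j)) ⊆ B ∧ volume.real B = ∏ j, (b j - a j) := by
  obtain ⟨I, hI, rfl⟩ := hB
  have hne : (Set.univ.pi I).Nonempty := by
    by_contra h
    rw [Set.not_nonempty_iff_eq_empty] at h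
    simp [h] at hpos
  have hIne : ∀ j, (I j).Nonempty := fun j => ⟨hne.some j, hne.some_mem j trivial⟩
  have hbb : ∀ j, BddBelow (I j) := fun j => bddBelow_Icc.mono (hI j).2
  have hba : ∀ j, BddAbove (I j) := fun j => bddAbove_Icc.mono (hI j).2
  have hIoo : ∀ j, Set.Ioo (sInf (I j)) (sSup (I j)) ⊆ I j := fun j =>
    IsConnected.Ioo_csInf_csSup_subset ⟨hIne j, (hI j).1.isPreconnected⟩ (hbb j) (hba j)
  have hIcc : ∀ j, I j ⊆ Set.Icc (sInf (I j)) (sSup (I j)) := fun j =>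
    subset_Icc_csInf_csSup (hbb j) (hba j)
  have hvolI : ∀ j, volume (I j) = ENNReal.ofReal (sSup (I j) - sInf (I j)) := fun j =>
    le_antisymm ((measure_mono (hIcc j)).trans_eq Real.volume_Icc)
      (Real.volume_Ioo.symm.trans_le (measure_mono (hIoo j)))
  have hle : ∀ j, sInf (I j) ≤ sSup (I j) := fun j =>
    csInf_le_csSup (hIne j) (hbb j) (hba j)
  have hvol : volume.real (Set.univ.pi I) = ∏ j, (sSup (I j) - sInf (I j)) := by
    rw [measureReal_def, volume_pi_pi, ENNReal.toReal_prod]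
    refine Finset.prod_congr rfl fun j _ => ?_
    rw [hvolI, ENNReal.toReal_ofReal (sub_nonneg.2 (hle j))]
  refine ⟨fun j => sInf (I j), fun j => sSup (I j), fun j => ⟨?_, ?_, ?_⟩, ?_, hvol⟩
  · exact le_csInf (hIne j) fun x hx => ((hI j).2 hx).1
  · refine lt_of_le_of_ne (hle j) fun h => ?_
    rw [hvol, Finset.prod_eq_zero (Finset.mem_univ j) (sub_eq_zero.2 h.symm)] at hpos
    exact lt_irrefl _ hpos
  · exact csSup_le (hIne j) fun x hx => ((hI j).2 hx).2
  · exact Set.pi_mono fun j _ => hIoo j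

/-- Factors are replaced one at a time; since all the others lie in `[0,1]`, each replacement costs
at most `c`. This bounds the volume lost when every side of a box is shortened. -/
theorem prod_sub_card_mul_le_prod {ι : Type*} (s : Finset ι) {f g : ι → ℝ} {c : ℝ} (hc : 0 ≤ c)
    (hf : ∀ i, 0 ≤ f i ∧ f i ≤ 1) (hg : ∀ i, 0 ≤ g i ∧ g i ≤ 1) (hfg : ∀ i, f i - c ≤ g i) :
    ∏ i ∈ s, f i - s.card * c ≤ ∏ i ∈ s, g i := by
  classical
  induction s using Finset.induction_on with
  | empty => simp
  | insert a s ha ih =>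
    rw [Finset.prod_insert ha, Finset.prod_insert ha, Finset.card_insert_of_notMem ha]
    have hF0 : 0 ≤ ∏ i ∈ s, f i := Finset.prod_nonneg fun i _ => (hf i).1
    have hF1 : ∏ i ∈ s, f i ≤ 1 := Finset.prod_le_one (fun i _ => (hf i).1) fun i _ => (hf i).2
    have h1 := mul_le_mul_of_nonneg_right (hfg a) hF0
    have h2 := mul_le_mul_of_nonneg_left ih (hg a).1
    have h3 : c * ∏ i ∈ s, f i ≤ c := mul_le_of_le_one_right hc hF1
    have h4 : g a * (s.card * c) ≤ s.card * c :=
      mul_le_of_le_one_left (by positivity) (hg a).2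
    push_cast
    linarith

theorem isUnitBox_pi_Icc {d : ℕ} {a b : Fin d → ℝ} (ha : ∀ j, 0 ≤ a j) (hb : ∀ j, b j ≤ 1) :
    IsUnitBox (Set.univ.pi fun j => Set.Icc (a j) (b j)) :=
  ⟨_, fun j => ⟨Set.ordConnected_Icc, Set.Icc_subset_Icc (ha j) (hb j)⟩, rfl⟩

/-- Every box contains closed boxes of almost the same volume. -/
theorem IsUnitBox.exists_isClosed_subset {d : ℕ} {B : Set (Fin d → ℝ)} (hB : IsUnitBox B)
    {t : ℝ} (ht : 0 ≤ t) (htB : t < volume.real B) :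
    ∃ C ⊆ B, IsUnitBox C ∧ IsClosed C ∧ t < volume.real C := by
  obtain ⟨a, b, hab, hsub, hvol⟩ := hB.exists_endpoints (ht.trans_lt htB)
  obtain ⟨h, hh0, hh⟩ : ∃ h : ℝ, 0 < h ∧ d * (2 * h) < volume.real B - t := by
    refine ⟨(volume.real B - t) / (2 * (d + 1)), div_pos (by linarith) (by positivity), ?_⟩
    have : (d : ℝ) * (2 * ((volume.real B - t) / (2 * (d + 1)))) =
        (volume.real B - t) * (d / (d + 1)) := by field_simp
    rw [this]
    refine mul_lt_of_lt_one_right (by linarith) ?_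
    rw [div_lt_one (by positivity)]
    linarith
  refine ⟨Set.univ.pi fun j => Set.Icc (a j + h) (b j - h), ?_, ?_, ?_, ?_⟩
  · refine (Set.pi_mono fun j _ x hx => ?_).trans hsub
    exact ⟨by linarith [hx.1], by linarith [hx.2]⟩
  · exact isUnitBox_pi_Icc (fun j => by linarith [(hab j).1]) fun j => by linarith [(hab j).2.2]
  · exact isClosed_set_pi fun j _ => isClosed_Icc
  · have key := prod_sub_card_mul_le_prod Finset.univ (f := fun j => b j - a j)
      (g := fun j => max (b j - h - (a j + h)) 0) (c := 2 * h) (by positivity)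
      (fun j => ⟨by linarith [(hab j).2.1], by linarith [hab j]⟩)
      (fun j => ⟨le_max_right _ _, max_le (by linarith [hab j]) zero_le_one⟩)
      (fun j => le_max_of_le_left (by linarith))
    rw [measureReal_def, volume_pi_pi, ENNReal.toReal_prod]
    simp only [Real.volume_Icc, ENNReal.toReal_ofReal']
    simp only [Finset.card_univ, Fintype.card_fin, ← hvol] at key
    linarith

/-! ### Bounds, measurability and i.i.d. representation of the dispersion. -/

theorem dispersion_bddAbove {n d : ℕ} (x : Fin n → Fin d → ℝ) :
    BddAbove {v : ℝ | ∃ B : Set (Fin d → ℝ), IsUnitBox B ∧ (∀ i, x i ∉ B) ∧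
      v = volume.real B} := by
  refine ⟨1, ?_⟩
  rintro v ⟨B, hB, -, rfl⟩
  exact hB.volume_real_le_one

theorem dispersion_nonneg {n d : ℕ} (x : Fin n → Fin d → ℝ) : 0 ≤ dispersion x := by
  refine Real.sSup_nonneg ?_
  rintro v ⟨B, -, -, rfl⟩
  exact measureReal_nonneg

theorem dispersion_le_one {n d : ℕ} (x : Fin n → Fin d → ℝ) : dispersion x ≤ 1 := by
  refine Real.sSup_le ?_ zero_le_one
  rintro v ⟨B, hB, -, rfl⟩
  exact hB.volume_real_le_one

theorem volume_real_le_dispersion {n d : ℕ} {x : Fin n → Fin d → ℝ} {B : Set (Fin d → ℝ)}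
    (hB : IsUnitBox B) (hx : ∀ i, x i ∉ B) : volume.real B ≤ dispersion x :=
  le_csSup (dispersion_bddAbove x) ⟨B, hB, hx, rfl⟩

theorem exists_box_of_lt_dispersion {n d : ℕ} {x : Fin n → Fin d → ℝ} {t : ℝ} (ht : 0 ≤ t)
    (h : t < dispersion x) :
    ∃ B : Set (Fin d → ℝ), IsUnitBox B ∧ (∀ i, x i ∉ B) ∧ t < volume.real B := by
  by_contra! hcon
  refine h.not_ge (Real.sSup_le ?_ ht)
  rintro v ⟨B, hB, hx, rfl⟩
  exact hcon B hB hx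

/-- A nearly optimal empty box can be taken closed, and a closed box avoided by the points is still
avoided after a small perturbation. This yields measurability although the supremum runs over
uncountably many boxes. -/
theorem lowerSemicontinuous_dispersion (n d : ℕ) :
    LowerSemicontinuous (dispersion : (Fin n → Fin d → ℝ) → ℝ) := by
  intro x t ht
  rcases lt_or_ge t 0 with h0 | h0
  · exact Filter.Eventually.of_forall fun y => h0.trans_le (dispersion_nonneg y)
  obtain ⟨B, hB, hx, htB⟩ := exists_box_of_lt_dispersion h0 ht
  obtain ⟨C, hCB, hC, hCc, htC⟩ := hB.exists_isClosed_subset h0 htB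
  have : ∀ᶠ y : Fin n → Fin d → ℝ in nhds x, ∀ i, y i ∈ Cᶜ :=
    Filter.eventually_all.2 fun i =>
      (continuous_apply i).continuousAt.eventually_mem
        (hCc.isOpen_compl.mem_nhds fun h => hx i (hCB h))
  filter_upwards [this] with y hy
  exact htC.trans_le (volume_real_le_dispersion hC hy)

theorem measurable_dispersion (n d : ℕ) :
    Measurable (dispersion : (Fin n → Fin d → ℝ) → ℝ) :=
  (lowerSemicontinuous_dispersion n d).measurable

theorem integrable_dispersion {n d : ℕ} (μ : Measure (Fin n → Fin d → ℝ)) [IsFiniteMeasure μ] :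
    Integrable dispersion μ := by
  refine Integrable.of_bound (measurable_dispersion n d).aestronglyMeasurable 1
    (Filter.Eventually.of_forall fun x => ?_)
  rw [Real.norm_eq_abs, abs_of_nonneg (dispersion_nonneg x)]
  exact dispersion_le_one x

theorem hasLaw_pi_of_iIndepFun {d : ℕ} {Ω : Type*} [MeasurableSpace Ω] {P : Measure Ω}
    [IsProbabilityMeasure P] {X : ℕ → Ω → Fin d → ℝ} (hX : iIndepFun X P)
    (hlaw : ∀ i, HasLaw (X i) (uniformCube d) P) (n : ℕ) :
    HasLaw (fun ω (i : Fin n) => X i ω) (Measure.pi fun _ => uniformCube d) P := by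
  have h := hX.precomp (g := fun i : Fin n => (i : ℕ)) Fin.val_injective
  have hm : ∀ i : Fin n, AEMeasurable (X i) P := fun i => (hlaw i).aemeasurable
  refine ⟨aemeasurable_pi_lambda _ hm, ?_⟩
  refine ((iIndepFun_iff_map_fun_eq_pi_map hm).1 h).trans ?_
  congr 1
  funext i
  exact (hlaw i).map_eq

theorem integrable_dispersion_of_iIndepFun {d : ℕ} {Ω : Type*} [MeasurableSpace Ω]
    {P : Measure Ω} [IsProbabilityMeasure P] {X : ℕ → Ω → Fin d → ℝ} (hX : iIndepFun X P)
    (hlaw : ∀ i, HasLaw (X i) (uniformCube d) P) (n : ℕ) :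
    Integrable (fun ω => dispersion fun i : Fin n => X i ω) P := by
  have h := hasLaw_pi_of_iIndepFun hX hlaw n
  have := integrable_dispersion (Measure.pi fun _ : Fin n => uniformCube d)
  rw [← h.map_eq] at this
  exact this.comp_aemeasurable h.aemeasurable

theorem integral_dispersion_of_iIndepFun {d : ℕ} {Ω : Type*} [MeasurableSpace Ω]
    {P : Measure Ω} [IsProbabilityMeasure P] {X : ℕ → Ω → Fin d → ℝ} (hX : iIndepFun X P)
    (hlaw : ∀ i, HasLaw (X i) (uniformCube d) P) (n : ℕ) :
    ∫ ω, dispersion (fun i : Fin n => X i ω) ∂P = expectedDispersion n d := by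
  have h := hasLaw_pi_of_iIndepFun hX hlaw n
  rw [expectedDispersion, ← h.map_eq,
    integral_map h.aemeasurable (measurable_dispersion n d).aestronglyMeasurable]

/-! ### Lower bound linear in the dimension. -/

theorem uniformCube_real_norm_lt_le {d : ℕ} {r : ℝ} (hr : 0 ≤ r) :
    (uniformCube d).real {x | ‖x‖ < r} ≤ r ^ d := by
  have hsub : {x : Fin d → ℝ | ‖x‖ < r} ∩ Set.Icc 0 1 ⊆ Set.Icc 0 (fun _ => r) := by
    rintro x ⟨hx, hx0, -⟩
    exact ⟨hx0, fun j => (Real.le_norm_self _).trans ((norm_le_pi_norm x j).trans hx.le)⟩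
  have hvol : volume.real (Set.Icc (0 : Fin d → ℝ) fun _ => r) = r ^ d := by
    rw [measureReal_def, Real.volume_Icc_pi_toReal (a := 0) (fun _ => hr)]
    simp
  rw [uniformCube, measureReal_restrict_apply (measurableSet_lt measurable_norm measurable_const),
    ← hvol]
  exact measureReal_mono hsub isCompact_Icc.measure_lt_top.ne

/-- Layer-cake formula: the level set at height `t` is the complement of a max-norm ball of radius
`s * t`, which has measure at most `(s * t) ^ d`. -/
theorem one_sub_le_integral_min_norm_div {d : ℕ} {s : ℝ} (hs : 0 < s) :
    1 - s ^ d / (d + 1) ≤ ∫ x, min (‖x‖ / s) 1 ∂uniformCube d := by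
  have hmeas : Measurable fun x : Fin d → ℝ => min (‖x‖ / s) 1 := by fun_prop
  have hnn : ∀ x : Fin d → ℝ, 0 ≤ min (‖x‖ / s) 1 := fun x => by positivity
  have hint : Integrable (fun x : Fin d → ℝ => min (‖x‖ / s) 1) (uniformCube d) := by
    refine Integrable.of_bound hmeas.aestronglyMeasurable 1 (Filter.Eventually.of_forall fun x => ?_)
    rw [Real.norm_eq_abs, abs_of_nonneg (hnn x)]
    exact min_le_right _ _
  rw [hint.integral_eq_integral_Ioc_meas_le (M := 1) (Filter.Eventually.of_forall hnn)
    (Filter.Eventually.of_forall fun x => min_le_right _ _)]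
  have hpoint : ∀ t ∈ Set.Ioc (0 : ℝ) 1, 1 - s ^ d * t ^ d ≤
      (uniformCube d).real {x | t ≤ min (‖x‖ / s) 1} := by
    intro t ht
    have hset : {x : Fin d → ℝ | t ≤ min (‖x‖ / s) 1} = {x | ‖x‖ < s * t}ᶜ := by
      ext x
      simp only [Set.mem_ofPred_eq, Set.mem_compl_iff, not_lt, le_min_iff, ht.2, and_true]
      rw [le_div_iff₀ hs, mul_comm]
    rw [hset, probReal_compl_eq_one_sub (measurableSet_lt measurable_norm measurable_const),
      ← mul_pow]
    linarith [uniformCube_real_norm_lt_le (d := d) (mul_pos hs ht.1).le]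
  have hval : ∫ t in Set.Ioc (0 : ℝ) 1, (1 - s ^ d * t ^ d) = 1 - s ^ d / (d + 1) := by
    rw [← intervalIntegral.integral_of_le zero_le_one, intervalIntegral.integral_sub
      (by simp) (Continuous.intervalIntegrable (by fun_prop) _ _),
      intervalIntegral.integral_const_mul, integral_pow]
    simp
    ring
  rw [← hval]
  refine setIntegral_mono_on ?_ ?_ measurableSet_Ioc hpoint
  · exact (Continuous.integrableOn_Icc (by fun_prop)).mono_set Set.Ioc_subset_Icc_self
  · have hanti : Antitone fun t : ℝ => (uniformCube d).real {x | t ≤ min (‖x‖ / s) 1} :=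
      fun t u htu => measureReal_mono fun x hx => htu.trans hx
    exact ((hanti.antitoneOn _).integrableOn_isCompact isCompact_Icc).mono_set Set.Ioc_subset_Icc_self

theorem exists_norm_apply_eq_norm {d : ℕ} (hd : 1 ≤ d) (x : Fin d → ℝ) : ∃ j, ‖x j‖ = ‖x‖ := by
  have : Nonempty (Fin d) := ⟨⟨0, hd⟩⟩
  obtain ⟨j, hj⟩ := Finite.exists_max fun j => ‖x j‖
  exact ⟨j, le_antisymm (norm_le_pi_norm x j) ((pi_norm_le_iff_of_nonempty x).2 hj)⟩

/-- Cutting off each point along its largest coordinate leaves an empty box. -/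
theorem pow_mul_prod_min_norm_div_le_dispersion {n d : ℕ} (hd : 1 ≤ d) {s : ℝ} (hs : 0 < s)
    (hs1 : s ≤ 1) (x : Fin n → Fin d → ℝ) :
    s ^ d * ∏ i, min (‖x i‖ / s) 1 ≤ dispersion x := by
  choose J hJ using fun i => exists_norm_apply_eq_norm hd (x i)
  have hm0 : ∀ i, 0 ≤ min (‖x i‖ / s) 1 := fun i => by positivity
  have hm1 : ∀ i, min (‖x i‖ / s) 1 ≤ 1 := fun i => min_le_right _ _
  -- Side `j` carries the factors of all points assigned to it. Hence `b (J i) ≤ ‖x i‖`, and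
  -- regrouping the fibres of `J` turns the volume into a product over the points.
  set b : Fin d → ℝ := fun j => s * ∏ i with J i = j, min (‖x i‖ / s) 1 with hb
  have hb0 : ∀ j, 0 ≤ b j := fun j => mul_nonneg hs.le (Finset.prod_nonneg fun i _ => hm0 i)
  have hb1 : ∀ j, b j ≤ 1 := fun j => mul_le_one₀ hs1 (Finset.prod_nonneg fun i _ => hm0 i)
    (Finset.prod_le_one (fun i _ => hm0 i) fun i _ => hm1 i)
  have hbJ : ∀ i, b (J i) ≤ ‖x i‖ := by
    intro i
    have : ∏ i' with J i' = J i, min (‖x i'‖ / s) 1 ≤ min (‖x i‖ / s) 1 := by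
      rw [← Finset.mul_prod_erase (Finset.univ.filter fun i' => J i' = J i) _
        (by simp : i ∈ Finset.univ.filter fun i' => J i' = J i)]
      exact mul_le_of_le_one_right (hm0 i)
        (Finset.prod_le_one (fun i _ => hm0 i) fun i _ => hm1 i)
    calc b (J i) ≤ s * (‖x i‖ / s) :=
          mul_le_mul_of_nonneg_left (this.trans (min_le_left _ _)) hs.le
      _ = ‖x i‖ := by field_simp
  have hvol : volume.real (Set.univ.pi fun j => Set.Ico 0 (b j)) =
      s ^ d * ∏ i, min (‖x i‖ / s) 1 := by
    rw [measureReal_def, volume_pi_pi, ENNReal.toReal_prod]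
    simp only [Real.volume_Ico, sub_zero, ENNReal.toReal_ofReal (hb0 _)]
    rw [hb, Finset.prod_mul_distrib, Finset.prod_const, Finset.card_univ, Fintype.card_fin,
      Finset.prod_fiberwise]
  rw [← hvol]
  refine volume_real_le_dispersion ⟨_, fun j => ⟨Set.ordConnected_Ico, ?_⟩, rfl⟩ fun i hi => ?_
  · exact Set.Ico_subset_Icc_self.trans (Set.Icc_subset_Icc le_rfl (hb1 j))
  · have h := hi (J i) trivial
    have h1 := hbJ i
    rw [← hJ i, Real.norm_of_nonneg h.1] at h1
    exact absurd h.2 h1.not_gt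

theorem mul_one_sub_pow_le_expectedDispersion {n d : ℕ} (hd : 1 ≤ d) {v : ℝ} (hv : 0 < v)
    (hv1 : v ≤ 1) : v * (1 - v / (d + 1)) ^ n ≤ expectedDispersion n d := by
  set s : ℝ := v ^ (1 / (d : ℝ)) with hs
  have hs0 : 0 < s := Real.rpow_pos_of_pos hv _
  have hs1 : s ≤ 1 := Real.rpow_le_one hv.le hv1 (by positivity)
  have hsd : s ^ d = v := by
    rw [hs, one_div, Real.rpow_inv_natCast_pow hv.le (by omega)]
  have hlow := one_sub_le_integral_min_norm_div (d := d) hs0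
  rw [hsd] at hlow
  have hnn : 0 ≤ 1 - v / (d + 1) := by
    rw [sub_nonneg, div_le_one (by positivity)]
    linarith [(Nat.cast_nonneg d : (0 : ℝ) ≤ d)]
  have hprod := integral_fintype_prod_eq_pow (ι := Fin n) (μ := uniformCube d)
    fun x => min (‖x‖ / s) 1
  rw [Fintype.card_fin] at hprod
  calc v * (1 - v / (d + 1)) ^ n
      ≤ v * (∫ x, min (‖x‖ / s) 1 ∂uniformCube d) ^ n := by gcongr
    _ = ∫ x : Fin n → Fin d → ℝ, s ^ d * ∏ i, min (‖x i‖ / s) 1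
          ∂(Measure.pi fun _ => uniformCube d) := by
        rw [integral_const_mul, hprod, hsd]
    _ ≤ expectedDispersion n d := by
        refine integral_mono_of_nonneg (Filter.Eventually.of_forall fun x => ?_)
          (integrable_dispersion _) (Filter.Eventually.of_forall fun x =>
            pow_mul_prod_min_norm_div_le_dispersion hd hs0 hs1 x)
        exact mul_nonneg (by positivity) (Finset.prod_nonneg fun i _ => by positivity)

theorem exp_neg_one_le_one_sub_inv_pow (n : ℕ) :
    Real.exp (-1) ≤ (1 - 1 / ((n : ℝ) + 1)) ^ n := by
  rcases Nat.eq_zero_or_pos n with rfl | hn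
  · simp
  have hn' : (0 : ℝ) < n := by exact_mod_cast hn
  have h1 : (1 + 1 / (n : ℝ)) ^ n ≤ Real.exp 1 := by
    calc (1 + 1 / (n : ℝ)) ^ n ≤ Real.exp (1 / n) ^ n := by
          gcongr
          linarith [Real.add_one_le_exp (1 / (n : ℝ))]
      _ = Real.exp 1 := by rw [← Real.exp_nat_mul]; congr 1; field_simp
  have h2 : 1 - 1 / ((n : ℝ) + 1) = (1 + 1 / (n : ℝ))⁻¹ := by field_simp; ring
  rw [h2, inv_pow, Real.exp_neg]
  gcongr

theorem div_le_expectedDispersion {n d : ℕ} (hd : 1 ≤ d) (hdn : d ≤ n) :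
    d / (2 * Real.exp 1 * n) ≤ expectedDispersion n d := by
  have hd' : (1 : ℝ) ≤ d := by exact_mod_cast hd
  have hdn' : (d : ℝ) ≤ n := by exact_mod_cast hdn
  have hn' : (0 : ℝ) < n := by linarith
  -- This `v` maximises `v * (1 - v / (d + 1)) ^ n`; it is at most `1` because `d ≤ n`.
  have h := mul_one_sub_pow_le_expectedDispersion (n := n) hd (v := ((d : ℝ) + 1) / (n + 1))
    (by positivity) ((div_le_one (by positivity)).2 (by linarith))
  have h2 : ((d : ℝ) + 1) / (n + 1) / (d + 1) = 1 / (n + 1) := by field_simp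
  rw [h2] at h
  have he := Real.exp_pos 1
  calc d / (2 * Real.exp 1 * n) ≤ (d + 1) / (n + 1) * Real.exp (-1) := by
        rw [Real.exp_neg, ← div_eq_mul_inv, div_div, div_le_div_iff₀ (by positivity) (by positivity)]
        nlinarith [mul_nonneg he.le (sub_nonneg.2 hdn'), mul_pos he (by linarith : (0:ℝ) < n),
          mul_nonneg (mul_nonneg he.le (by linarith : (0:ℝ) ≤ n)) (by linarith : (0:ℝ) ≤ d)]
    _ ≤ _ := (mul_le_mul_of_nonneg_left (exp_neg_one_le_one_sub_inv_pow n) (by positivity)).trans h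

theorem exp_neg_one_le_expectedDispersion {n d : ℕ} (hd : 1 ≤ d) (hnd : n ≤ d) :
    Real.exp (-1) ≤ expectedDispersion n d := by
  have h := mul_one_sub_pow_le_expectedDispersion (n := n) hd zero_lt_one le_rfl
  rw [one_mul] at h
  refine ((exp_neg_one_le_one_sub_inv_pow d).trans ?_).trans h
  refine pow_le_pow_of_le_one ?_ (by simp; positivity) hnd
  rw [sub_nonneg, div_le_one (by positivity)]
  linarith [(Nat.cast_nonneg d : (0 : ℝ) ≤ d)]

/-! ### Lower bound with the logarithm, by the second moment method. -/

/-- The indicator of the event that none of the points `x i` lies in `S`. -/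
noncomputable def avoidIndicator {α : Type*} {n : ℕ} (S : Set α) (x : Fin n → α) : ℝ :=
  ∏ i, Sᶜ.indicator 1 (x i)

theorem avoidIndicator_of_forall_notMem {α : Type*} {n : ℕ} {S : Set α} {x : Fin n → α}
    (h : ∀ i, x i ∉ S) : avoidIndicator S x = 1 :=
  Finset.prod_eq_one fun i _ => Set.indicator_of_mem (h i) _

theorem avoidIndicator_of_exists_mem {α : Type*} {n : ℕ} {S : Set α} {x : Fin n → α}
    (h : ∃ i, x i ∈ S) : avoidIndicator S x = 0 := by
  obtain ⟨i, hi⟩ := h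
  exact Finset.prod_eq_zero (Finset.mem_univ i) (Set.indicator_of_notMem (by simpa using hi) _)

theorem avoidIndicator_nonneg {α : Type*} {n : ℕ} (S : Set α) (x : Fin n → α) :
    0 ≤ avoidIndicator S x :=
  Finset.prod_nonneg fun _ _ => Set.indicator_nonneg (fun _ _ => zero_le_one) _

theorem avoidIndicator_mul {α : Type*} {n : ℕ} (S T : Set α) (x : Fin n → α) :
    avoidIndicator S x * avoidIndicator T x = avoidIndicator (S ∪ T) x := by
  rw [avoidIndicator, avoidIndicator, avoidIndicator, ← Finset.prod_mul_distrib]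
  refine Finset.prod_congr rfl fun i _ => ?_
  by_cases hS : x i ∈ S <;> by_cases hT : x i ∈ T <;> simp [hS, hT]

section

variable {α : Type*} [MeasurableSpace α] {n : ℕ} (μ : Measure α) [IsProbabilityMeasure μ]
  {S : Set α}

theorem integrable_avoidIndicator (hS : MeasurableSet S) :
    Integrable (avoidIndicator S : (Fin n → α) → ℝ) (Measure.pi fun _ => μ) :=
  Integrable.fintype_prod (f := fun _ : Fin n => Sᶜ.indicator (1 : α → ℝ)) fun _ =>
    (integrable_const (1 : ℝ)).indicator hS.compl

theorem integral_avoidIndicator (hS : MeasurableSet S) :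
    ∫ x : Fin n → α, avoidIndicator S x ∂(Measure.pi fun _ => μ) = (1 - μ.real S) ^ n := by
  have h := integral_fintype_prod_eq_pow (ι := Fin n) (μ := μ) (Sᶜ.indicator (1 : α → ℝ))
  rw [Fintype.card_fin, integral_indicator_one hS.compl, probReal_compl_eq_one_sub hS] at h
  exact h

end

/-- Second moment bound: with `m` disjoint cells of measure `1 / m`, the probability that some
cell contains none of `n` independent points is at least `1 / (1 + 1 / z)`, where `z` is the
expected number of empty cells. -/
theorem mul_div_one_add_le_integral_of_empty_cell {α : Type*} [MeasurableSpace α] {n m : ℕ}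
    (hm : 2 ≤ m) (μ : Measure α) [IsProbabilityMeasure μ] {S : Fin m → Set α}
    (hS : ∀ j, MeasurableSet (S j)) (hdisj : Pairwise fun j k => Disjoint (S j) (S k))
    (hμ : ∀ j, μ.real (S j) = 1 / m) {D : (Fin n → α) → ℝ}
    (hD : Integrable D (Measure.pi fun _ => μ)) (hD0 : ∀ x, 0 ≤ D x) {w : ℝ} (hw : 0 ≤ w)
    (hDw : ∀ x, (∃ j, ∀ i, x i ∉ S j) → w ≤ D x) :
    w * ((m * (1 - 1 / m) ^ n) / (1 + m * (1 - 1 / m) ^ n)) ≤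
      ∫ x, D x ∂(Measure.pi fun _ => μ) := by
  have hm' : (2 : ℝ) ≤ m := by exact_mod_cast hm
  set q : ℝ := (1 - 1 / (m : ℝ)) ^ n with hq
  have hq0 : 0 ≤ q := pow_nonneg (by rw [sub_nonneg, div_le_one (by linarith)]; linarith) n
  set z : ℝ := m * q with hz
  have hz0 : 0 ≤ z := by positivity
  set c : ℝ := 1 / (1 + z) with hc
  have hint : ∀ j, Integrable (fun x : Fin n → α => avoidIndicator (S j) x)
      (Measure.pi fun _ => μ) := fun j => integrable_avoidIndicator μ (hS j)
  have hint2 : ∀ j k, Integrable (fun x : Fin n → α => avoidIndicator (S j ∪ S k) x)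
      (Measure.pi fun _ => μ) := fun j k => integrable_avoidIndicator μ ((hS j).union (hS k))
  have hsq : ∀ x : Fin n → α, (∑ j, avoidIndicator (S j) x) ^ 2 =
      ∑ j, ∑ k, avoidIndicator (S j ∪ S k) x := by
    intro x
    rw [sq, Finset.sum_mul_sum]
    simp only [avoidIndicator_mul]
  have hE1 : ∫ x : Fin n → α, ∑ j, avoidIndicator (S j) x ∂(Measure.pi fun _ => μ) = z := by
    rw [integral_finsetSum _ fun j _ => hint j]
    simp only [integral_avoidIndicator μ (hS _), hμ]
    simp [hz, hq]
  have hpair : ∀ j k, ∫ x : Fin n → α, avoidIndicator (S j ∪ S k) x ∂(Measure.pi fun _ => μ) ≤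
      q ^ 2 + if j = k then q else 0 := by
    intro j k
    rw [integral_avoidIndicator μ ((hS j).union (hS k))]
    by_cases hjk : j = k
    · subst hjk
      simp only [Set.union_self, hμ, if_true]
      nlinarith
    · rw [measureReal_union (hdisj hjk) (hS k), hμ, hμ, if_neg hjk, add_zero, hq, ← pow_mul,
        mul_comm n 2, pow_mul]
      have h2 : (0 : ℝ) ≤ 1 - (1 / m + 1 / m) := by
        rw [sub_nonneg, ← add_div, div_le_one (by linarith)]
        linarith
      -- Emptiness of disjoint cells is negatively correlated: `1 - 2/m ≤ (1 - 1/m)²`.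
      refine pow_le_pow_left₀ h2 ?_ n
      nlinarith [sq_nonneg (1 / (m : ℝ))]
  have hE2 : ∫ x : Fin n → α, (∑ j, avoidIndicator (S j) x) ^ 2 ∂(Measure.pi fun _ => μ) ≤
      z ^ 2 + z := by
    simp only [hsq]
    rw [integral_finsetSum _ fun j _ => integrable_finsetSum _ fun k _ => hint2 j k]
    calc ∑ j, ∫ x : Fin n → α, ∑ k, avoidIndicator (S j ∪ S k) x ∂(Measure.pi fun _ => μ)
        = ∑ j, ∑ k, ∫ x : Fin n → α, avoidIndicator (S j ∪ S k) x ∂(Measure.pi fun _ => μ) :=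
          Finset.sum_congr rfl fun j _ => integral_finsetSum _ fun k _ => hint2 j k
      _ ≤ ∑ j : Fin m, ∑ k : Fin m, (q ^ 2 + if j = k then q else 0) :=
          Finset.sum_le_sum fun j _ => Finset.sum_le_sum fun k _ => hpair j k
      _ = z ^ 2 + z := by
          simp [Finset.sum_add_distrib, hz]
          ring
  have hi1 : Integrable (fun x : Fin n → α => ∑ j, avoidIndicator (S j) x)
      (Measure.pi fun _ => μ) := integrable_finsetSum _ fun j _ => hint j
  have hi2 : Integrable (fun x : Fin n → α => (∑ j, avoidIndicator (S j) x) ^ 2)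
      (Measure.pi fun _ => μ) := by
    simp only [hsq]
    exact integrable_finsetSum _ fun j _ => integrable_finsetSum _ fun k _ => hint2 j k
  have hpoint : ∀ x, w * (2 * c * (∑ j, avoidIndicator (S j) x) -
      c ^ 2 * (∑ j, avoidIndicator (S j) x) ^ 2) ≤ D x := by
    intro x
    by_cases hx : ∃ j, ∀ i, x i ∉ S j
    · refine le_trans (mul_le_of_le_one_right hw ?_) (hDw x hx)
      nlinarith [sq_nonneg (1 - c * ∑ j, avoidIndicator (S j) x)]
    · push Not at hx
      rw [Finset.sum_eq_zero fun j _ => avoidIndicator_of_exists_mem (hx j)]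
      simpa using hD0 x
  calc w * (z / (1 + z)) = w * (2 * c * z - c ^ 2 * (z ^ 2 + z)) := by
        rw [hc]; field_simp; ring
    _ ≤ w * (2 * c * (∫ x : Fin n → α, ∑ j, avoidIndicator (S j) x ∂(Measure.pi fun _ => μ)) -
        c ^ 2 * ∫ x : Fin n → α, (∑ j, avoidIndicator (S j) x) ^ 2 ∂(Measure.pi fun _ => μ)) := by
        rw [hE1]
        gcongr
    _ = ∫ x : Fin n → α, w * (2 * c * (∑ j, avoidIndicator (S j) x) -
        c ^ 2 * (∑ j, avoidIndicator (S j) x) ^ 2) ∂(Measure.pi fun _ => μ) := by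
        rw [integral_const_mul, integral_sub (hi1.const_mul _) (hi2.const_mul _),
          integral_const_mul, integral_const_mul]
    _ ≤ ∫ x, D x ∂(Measure.pi fun _ => μ) :=
        integral_mono (((hi1.const_mul _).sub (hi2.const_mul _)).const_mul _) hD hpoint

/-- The slab of points of the unit cube whose coordinate `l` lies in `[j / m, (j + 1) / m)`. -/
def unitSlab {d : ℕ} (l : Fin d) (m j : ℕ) : Set (Fin d → ℝ) :=
  Set.univ.pi fun k => if k = l then Set.Ico ((j : ℝ) / m) ((j + 1) / m) else Set.Icc 0 1

theorem isUnitBox_unitSlab {d m j : ℕ} (l : Fin d) (hj : j < m) : IsUnitBox (unitSlab l m j) := by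
  refine ⟨_, fun k => ?_, rfl⟩
  have hm : (0 : ℝ) < m := by exact_mod_cast (Nat.zero_le j).trans_lt hj
  have hj' : (j : ℝ) + 1 ≤ m := by exact_mod_cast hj
  split_ifs
  · refine ⟨Set.ordConnected_Ico, Set.Ico_subset_Icc_self.trans (Set.Icc_subset_Icc ?_ ?_)⟩
    · positivity
    · exact (div_le_one hm).2 hj'
  · exact ⟨Set.ordConnected_Icc, subset_rfl⟩

theorem volume_real_unitSlab {d m j : ℕ} (l : Fin d) :
    volume.real (unitSlab l m j) = 1 / m := by
  rw [measureReal_def, unitSlab, volume_pi_pi, Finset.prod_eq_single l]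
  · rw [if_pos rfl, Real.volume_Ico, ENNReal.toReal_ofReal]
    · ring
    · rw [← sub_div]; simp
  · intro k _ hk
    simp [hk]
  · simp

theorem measurableSet_unitSlab {d m j : ℕ} (l : Fin d) : MeasurableSet (unitSlab l m j) := by
  refine MeasurableSet.univ_pi fun k => ?_
  split_ifs
  exacts [measurableSet_Ico, measurableSet_Icc]

theorem disjoint_unitSlab {d m j k : ℕ} (l : Fin d) (hjk : j ≠ k) :
    Disjoint (unitSlab l m j) (unitSlab l m k) := by
  wlog h : j < k generalizing j k
  · exact (this hjk.symm (by omega)).symm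
  rw [Set.disjoint_left]
  intro x hx hx'
  have h1 := hx l trivial
  have h2 := hx' l trivial
  simp only [if_true] at h1 h2
  have h3 : ((j : ℝ) + 1) / m ≤ k / m := by
    gcongr
    exact_mod_cast h
  exact absurd (h1.2.trans_le h3) h2.1.not_gt

theorem inv_add_le_expectedDispersion {n d m : ℕ} (hd : 1 ≤ d) (hm : 2 ≤ m) :
    1 / (m + ((1 - 1 / (m : ℝ)) ^ n)⁻¹) ≤ expectedDispersion n d := by
  have hm' : (2 : ℝ) ≤ m := by exact_mod_cast hm
  have h := mul_div_one_add_le_integral_of_empty_cell (n := n) hm (uniformCube d)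
    (S := fun j => unitSlab ⟨0, hd⟩ m j) (fun j => measurableSet_unitSlab _)
    (fun j k hjk => disjoint_unitSlab _ fun h => hjk (Fin.ext h))
    (fun j => by
      rw [measureReal_def, uniformCube_apply_of_subset (isUnitBox_unitSlab _ j.2).subset_Icc]
      exact volume_real_unitSlab _)
    (D := dispersion) (integrable_dispersion _) dispersion_nonneg (w := 1 / m) (by positivity)
    (by
      rintro x ⟨j, hj⟩
      rw [← volume_real_unitSlab (m := m) (j := j) (⟨0, hd⟩ : Fin d)]
      exact volume_real_le_dispersion (isUnitBox_unitSlab _ j.2) hj)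
  refine le_trans (le_of_eq ?_) h
  have hq : 0 < (1 - 1 / (m : ℝ)) ^ n := by
    refine pow_pos ?_ n
    rw [sub_pos, div_lt_one (by linarith)]
    linarith
  generalize (1 - 1 / (m : ℝ)) ^ n = q at hq
  field_simp
  ring

theorem lt_expectedDispersion_of_lt_mul_log {n d : ℕ} (hd : 1 ≤ d) {x : ℝ} (hx : 1 < x)
    (hn : n < x * Real.log x) : 1 / (9 * x) < expectedDispersion n d := by
  -- The extra `1` gives `x ≤ m - 1`, so that `(1 - 1/m)⁻¹ ^ n ≤ exp (n / (m - 1)) ≤ x`. With `m < x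
  -- + 2` the denominator is below `2x + 2 < 9x`.
  set m : ℕ := ⌈x⌉₊ + 1 with hmdef
  have hxm : x ≤ m - 1 := by rw [hmdef]; push_cast; linarith [Nat.le_ceil x]
  have hmx : (m : ℝ) < x + 2 := by
    rw [hmdef]; push_cast; linarith [Nat.ceil_lt_add_one (by linarith : 0 ≤ x)]
  have hm : 2 ≤ m := by
    have : (1 : ℝ) < m := by linarith
    exact_mod_cast this
  refine lt_of_lt_of_le ?_ (inv_add_le_expectedDispersion (n := n) hd hm)
  have hinv : ((1 - 1 / (m : ℝ)) ^ n)⁻¹ ≤ x := by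
    have h1 : (1 - 1 / (m : ℝ))⁻¹ ≤ Real.exp (1 / (m - 1)) := by
      have hm1 : (m : ℝ) - 1 ≠ 0 := by linarith
      have hm0 : (m : ℝ) ≠ 0 := by linarith
      have : (1 - 1 / (m : ℝ))⁻¹ = 1 / (m - 1) + 1 := by
        rw [one_sub_div hm0, inv_div]; field_simp; ring
      rw [this]
      exact Real.add_one_le_exp _
    rw [← inv_pow]
    calc (1 - 1 / (m : ℝ))⁻¹ ^ n ≤ Real.exp (1 / (m - 1)) ^ n := by
          refine pow_le_pow_left₀ (inv_nonneg.2 ?_) h1 n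
          rw [sub_nonneg, div_le_one (by linarith)]
          linarith
      _ = Real.exp (n / (m - 1)) := by rw [← Real.exp_nat_mul]; congr 1; ring
      _ ≤ Real.exp (Real.log x) := by
          refine Real.exp_le_exp.2 ?_
          rw [div_le_iff₀ (by linarith)]
          nlinarith [Real.log_pos hx]
      _ = x := Real.exp_log (by linarith)
  have hq : 0 ≤ ((1 - 1 / (m : ℝ)) ^ n)⁻¹ := by
    refine inv_nonneg.2 (pow_nonneg ?_ n)
    rw [sub_nonneg, div_le_one (by linarith)]
    linarith
  exact one_div_lt_one_div_of_lt (by linarith) (by linarith)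

/-! ### Upper bound by discretisation and a union bound. -/

/-- The tuples of natural numbers with sum at most `M`. -/
def tuplesWithSumLE (ι : Type*) [Fintype ι] [DecidableEq ι] (M : ℕ) : Finset (ι → ℕ) :=
  (Fintype.piFinset fun _ : ι => Finset.range (M + 1)).filter fun k => ∑ i, k i ≤ M

theorem mem_tuplesWithSumLE {ι : Type*} [Fintype ι] [DecidableEq ι] {M : ℕ} {k : ι → ℕ} :
    k ∈ tuplesWithSumLE ι M ↔ ∑ i, k i ≤ M := by
  rw [tuplesWithSumLE, Finset.mem_filter, Fintype.mem_piFinset]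
  refine ⟨fun h => h.2, fun h => ⟨fun i => Finset.mem_range_succ_iff.2 ?_, h⟩⟩
  exact (Finset.single_le_sum (f := k) (fun _ _ => Nat.zero_le _) (Finset.mem_univ i)).trans h

/-- Generating-function bound: each tuple counted has weight `r ^ (∑ i, k i) ≥ r ^ M`, and the total
weight is at most a product of geometric series. -/
theorem card_tuplesWithSumLE_mul_pow_le {ι : Type*} [Fintype ι] [DecidableEq ι] (M : ℕ) {r : ℝ}
    (hr0 : 0 ≤ r) (hr1 : r < 1) :
    (tuplesWithSumLE ι M).card * r ^ M ≤ ((1 - r)⁻¹) ^ Fintype.card ι := by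
  calc ((tuplesWithSumLE ι M).card : ℝ) * r ^ M
      = ∑ k ∈ tuplesWithSumLE ι M, r ^ M := by simp
    _ ≤ ∑ k ∈ tuplesWithSumLE ι M, ∏ i, r ^ k i := by
        refine Finset.sum_le_sum fun k hk => ?_
        rw [Finset.prod_pow_eq_pow_sum]
        exact pow_le_pow_of_le_one hr0 hr1.le (mem_tuplesWithSumLE.1 hk)
    _ ≤ ∑ k ∈ Fintype.piFinset fun _ : ι => Finset.range (M + 1), ∏ i, r ^ k i :=
        Finset.sum_le_sum_of_subset_of_nonneg (Finset.filter_subset _ _) fun k _ _ =>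
          Finset.prod_nonneg fun i _ => pow_nonneg hr0 _
    _ = (∑ j ∈ Finset.range (M + 1), r ^ j) ^ Fintype.card ι := by
        rw [← Finset.prod_univ_sum, Finset.prod_const, Finset.card_univ]
    _ ≤ ((1 - r)⁻¹) ^ Fintype.card ι := by
        refine pow_le_pow_left₀ (Finset.sum_nonneg fun _ _ => pow_nonneg hr0 _) ?_ _
        rw [← tsum_geometric_of_lt_one hr0 hr1]
        exact (summable_geometric_of_lt_one hr0 hr1).sum_le_tsum _ fun _ _ => pow_nonneg hr0 _

theorem card_tuplesWithSumLE_le {ι : Type*} [Fintype ι] [DecidableEq ι] [Nonempty ι] {M : ℕ}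
    {T : ℝ} (hT : 0 < T) (hMT : M ≤ T) :
    ((tuplesWithSumLE ι M).card : ℝ) ≤
      (Real.exp 1 * (1 + T / Fintype.card ι)) ^ Fintype.card ι := by
  set m := Fintype.card ι with hm
  have hm0 : (0 : ℝ) < m := by exact_mod_cast Fintype.card_pos
  -- For this `r` the geometric factor is `1 + T / m`, while `r⁻¹ ^ M ≤ exp (m * M / T) ≤ exp m`.
  have h := card_tuplesWithSumLE_mul_pow_le (ι := ι) M (r := (1 + m / T)⁻¹) (by positivity)
    (inv_lt_one_of_one_lt₀ (by linarith [div_pos hm0 hT]))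
  have h1 : (1 - (1 + m / T)⁻¹)⁻¹ = 1 + T / m := by
    have h2 : 1 - (1 + m / T)⁻¹ = m / (m + T) := by
      rw [one_add_div hT.ne', inv_div, one_sub_div (by positivity)]
      ring
    rw [h2, inv_div, add_div, div_self hm0.ne']
  rw [h1, inv_pow, ← div_eq_mul_inv, div_le_iff₀ (by positivity)] at h
  refine h.trans ?_
  rw [mul_pow, mul_comm]
  refine mul_le_mul_of_nonneg_right ?_ (by positivity)
  calc (1 + m / T) ^ M ≤ Real.exp (m / T) ^ M := by
        gcongr
        linarith [Real.add_one_le_exp ((m : ℝ) / T)]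
    _ = Real.exp (M * (m / T)) := (Real.exp_nat_mul _ _).symm
    _ ≤ Real.exp (m * 1) := by
        refine Real.exp_le_exp.2 ?_
        rw [mul_one, ← mul_div_assoc, div_le_iff₀ hT]
        nlinarith
    _ = Real.exp 1 ^ m := Real.exp_nat_mul _ _

/-- Open boxes in the unit cube whose endpoints lie at multiples of `h` from the boundary. -/
def gridBox {d : ℕ} (h : ℝ) (k : Fin d ⊕ Fin d → ℕ) : Set (Fin d → ℝ) :=
  Set.univ.pi fun j =>
    Set.Ioo ((k (Sum.inl j) + 1) * h) (1 - (k (Sum.inr j) + 1) * h)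

theorem gridBox_subset_Icc {d : ℕ} {h : ℝ} (hh : 0 ≤ h) (k : Fin d ⊕ Fin d → ℕ) :
    gridBox h k ⊆ Set.Icc 0 1 := by
  intro x hx
  constructor
  · intro j
    have := (hx j trivial).1
    have h2 : 0 ≤ ((k (Sum.inl j) : ℝ) + 1) * h := by positivity
    exact (h2.trans_lt this).le
  · intro j
    have := (hx j trivial).2
    have h2 : 0 ≤ ((k (Sum.inr j) : ℝ) + 1) * h := by positivity
    exact this.le.trans (by simpa using h2)

theorem measurableSet_gridBox {d : ℕ} (h : ℝ) (k : Fin d ⊕ Fin d → ℕ) :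
    MeasurableSet (gridBox h k) :=
  MeasurableSet.univ_pi fun _ => measurableSet_Ioo

/-- From `1 - y ≤ -log y`. A lower bound on the volume thus bounds the total defect of the sides,
independently of the dimension. -/
theorem sum_one_sub_le_inv_of_le_prod {ι : Type*} [Fintype ι] {f : ι → ℝ} (hf : ∀ i, 0 < f i)
    {t : ℝ} (ht : 0 < t) (htf : t ≤ ∏ i, f i) : ∑ i, (1 - f i) ≤ 1 / t := by
  calc ∑ i, (1 - f i) ≤ ∑ i, -Real.log (f i) :=
        Finset.sum_le_sum fun i _ => by linarith [Real.log_le_sub_one_of_pos (hf i)]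
    _ = -Real.log (∏ i, f i) := by
        rw [Finset.sum_neg_distrib, Real.log_prod fun i _ => (hf i).ne']
    _ ≤ Real.log (1 / t) := by
        rw [one_div, Real.log_inv]
        exact neg_le_neg (Real.log_le_log ht htf)
    _ ≤ 1 / t := by linarith [Real.log_le_sub_one_of_pos (one_div_pos.2 ht)]

/-- A box of volume above `t` contains a grid box of almost the same volume whose index has sum
at most `1 / (t * h)`. -/
theorem IsUnitBox.exists_gridBox_subset {d : ℕ} {B : Set (Fin d → ℝ)} (hB : IsUnitBox B)
    {t h : ℝ} (ht : 0 < t) (hh : 0 < h) (htB : t < volume.real B) :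
    ∃ k ∈ tuplesWithSumLE (Fin d ⊕ Fin d) ⌊1 / (t * h)⌋₊, gridBox h k ⊆ B ∧
      t - d * (2 * h) ≤ volume.real (gridBox h k) := by
  obtain ⟨a, b, hab, hsub, hvol⟩ := hB.exists_endpoints (ht.trans htB)
  -- Rounding down keeps the index sum below the total defect divided by `h`; the shift `k + 1` in
  -- `gridBox` moves the endpoints inside the box, at a cost of at most `2 * h` per side.
  set k : Fin d ⊕ Fin d → ℕ := Sum.elim (fun j => ⌊a j / h⌋₊) fun j => ⌊(1 - b j) / h⌋₊ with hk
  have hal : ∀ j, (k (Sum.inl j) : ℝ) * h ≤ a j := fun j => by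
    rw [← le_div_iff₀ hh]
    exact Nat.floor_le (div_nonneg (hab j).1 hh.le)
  have hau : ∀ j, a j < (k (Sum.inl j) + 1) * h := fun j => by
    rw [← div_lt_iff₀ hh]
    exact Nat.lt_floor_add_one _
  have hbl : ∀ j, (k (Sum.inr j) : ℝ) * h ≤ 1 - b j := fun j => by
    rw [← le_div_iff₀ hh]
    exact Nat.floor_le (div_nonneg (by linarith [hab j]) hh.le)
  have hbu : ∀ j, 1 - b j < (k (Sum.inr j) + 1) * h := fun j => by
    rw [← div_lt_iff₀ hh]
    exact Nat.lt_floor_add_one _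
  refine ⟨k, mem_tuplesWithSumLE.2 (Nat.le_floor ?_), ?_, ?_⟩
  · have h1 := sum_one_sub_le_inv_of_le_prod (f := fun j => b j - a j)
      (fun j => by linarith [(hab j).2.1]) ht (by rw [← hvol]; exact htB.le)
    rw [← div_div, le_div_iff₀ hh]
    refine le_trans ?_ h1
    rw [Fintype.sum_sum_type]
    push_cast
    rw [add_mul, Finset.sum_mul, Finset.sum_mul, ← Finset.sum_add_distrib]
    exact Finset.sum_le_sum fun j _ => by linarith [hal j, hbl j]
  · refine (Set.pi_mono fun j _ x hx => ?_).trans hsub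
    exact ⟨by linarith [hx.1, hau j], by linarith [hx.2, hbu j]⟩
  · have key := prod_sub_card_mul_le_prod Finset.univ (f := fun j => b j - a j)
      -- The truncation at `0` covers grid intervals that become empty.
      (g := fun j => max (1 - (k (Sum.inr j) + 1) * h - (k (Sum.inl j) + 1) * h) 0)
      (c := 2 * h) (by positivity)
      (fun j => ⟨by linarith [(hab j).2.1], by linarith [hab j]⟩)
      (fun j => ⟨le_max_right _ _, max_le (by linarith [hab j, hau j, hbu j]) zero_le_one⟩)
      (fun j => le_max_of_le_left (by linarith [hal j, hbl j]))
    rw [measureReal_def, gridBox, volume_pi_pi, ENNReal.toReal_prod]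
    simp only [Real.volume_Ioo, ENNReal.toReal_ofReal']
    simp only [Finset.card_univ, Fintype.card_fin, ← hvol] at key
    linarith

/-- If the dispersion exceeds `t`, one of the grid boxes of volume at least `t - d * (2 * h)` is
empty; otherwise it is at most `t`. As the dispersion never exceeds `1`, counting empty grid boxes
dominates the excess. -/
theorem expectedDispersion_le_add {n d : ℕ} {t h : ℝ} (ht : 0 < t) (hh : 0 < h) :
    expectedDispersion n d ≤ t + (tuplesWithSumLE (Fin d ⊕ Fin d) ⌊1 / (t * h)⌋₊).card *
      Real.exp (-(n * (t - d * (2 * h)))) := by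
  set K := (tuplesWithSumLE (Fin d ⊕ Fin d) ⌊1 / (t * h)⌋₊).filter fun k =>
    t - d * (2 * h) ≤ volume.real (gridBox h k) with hK
  have hint : ∀ k, Integrable (fun x : Fin n → Fin d → ℝ => avoidIndicator (gridBox h k) x)
      (Measure.pi fun _ => uniformCube d) := fun k =>
    integrable_avoidIndicator _ (measurableSet_gridBox h k)
  have hpoint : ∀ x : Fin n → Fin d → ℝ,
      dispersion x ≤ t + ∑ k ∈ K, avoidIndicator (gridBox h k) x := by
    intro x
    have hnn : ∀ k ∈ K, 0 ≤ avoidIndicator (gridBox h k) x := fun k _ => avoidIndicator_nonneg _ _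
    rcases le_or_gt (dispersion x) t with hx | hx
    · linarith [Finset.sum_nonneg hnn]
    obtain ⟨B, hB, hxB, htB⟩ := exists_box_of_lt_dispersion ht.le hx
    obtain ⟨k, hk, hkB, hkv⟩ := hB.exists_gridBox_subset ht hh htB
    have h1 := Finset.single_le_sum hnn (Finset.mem_filter.2 ⟨hk, hkv⟩)
    rw [avoidIndicator_of_forall_notMem fun i hi => hxB i (hkB hi)] at h1
    linarith [dispersion_le_one x]
  have hterm : ∀ k ∈ K, ∫ x : Fin n → Fin d → ℝ, avoidIndicator (gridBox h k) x
      ∂(Measure.pi fun _ => uniformCube d) ≤ Real.exp (-(n * (t - d * (2 * h)))) := by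
    intro k hk
    rw [integral_avoidIndicator _ (measurableSet_gridBox h k)]
    have hv : t - d * (2 * h) ≤ (uniformCube d).real (gridBox h k) := by
      rw [measureReal_def, uniformCube_apply_of_subset (gridBox_subset_Icc hh.le k)]
      exact (Finset.mem_filter.1 hk).2
    calc (1 - (uniformCube d).real (gridBox h k)) ^ n
        ≤ Real.exp (-(t - d * (2 * h))) ^ n := by
          refine pow_le_pow_left₀ (sub_nonneg.2 measureReal_le_one) ?_ n
          linarith [Real.one_sub_le_exp_neg (t - d * (2 * h))]
      _ = Real.exp (-(n * (t - d * (2 * h)))) := by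
          rw [← Real.exp_nat_mul]; congr 1; ring
  calc expectedDispersion n d
      ≤ ∫ x : Fin n → Fin d → ℝ, (t + ∑ k ∈ K, avoidIndicator (gridBox h k) x)
          ∂(Measure.pi fun _ => uniformCube d) :=
        integral_mono (integrable_dispersion _)
          ((integrable_const t).add (integrable_finsetSum _ fun k _ => hint k)) hpoint
    _ = t + ∑ k ∈ K, ∫ x : Fin n → Fin d → ℝ, avoidIndicator (gridBox h k) x
          ∂(Measure.pi fun _ => uniformCube d) := by
        rw [integral_add (integrable_const t) (integrable_finsetSum _ fun k _ => hint k),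
          integral_finsetSum _ fun k _ => hint k]
        simp
    _ ≤ t + K.card * Real.exp (-(n * (t - d * (2 * h)))) := by
        have := Finset.sum_le_card_nsmul K _ _ hterm
        rw [nsmul_eq_mul] at this
        linarith
    _ ≤ _ := by
        gcongr
        exact Finset.filter_subset _ _

theorem expectedDispersion_le_of_mul_log_le {n d : ℕ} (hd : 1 ≤ d) {ε : ℝ} (hε : 0 < ε)
    (hε1 : ε ≤ 1 / 9)
    (hn : 9 * (1 + Real.exp (-1)) * (d / ε) * Real.log (9 * (Real.exp 1 + 1) / ε) ≤ n) :
    expectedDispersion n d ≤ ε := by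
  have : Nonempty (Fin d ⊕ Fin d) := ⟨Sum.inl ⟨0, hd⟩⟩
  have hd' : (1 : ℝ) ≤ d := by exact_mod_cast hd
  have he1 : (2.7 : ℝ) < Real.exp 1 := by linarith [Real.exp_one_gt_d9]
  have he2 : Real.exp 1 < 2.8 := by linarith [Real.exp_one_lt_d9]
  set Y : ℝ := 9 * (Real.exp 1 + 1) / ε with hY
  have hYε : 33 / ε ≤ Y := by rw [hY]; gcongr; linarith
  have hY1 : 4 / ε ≤ Y := le_trans (by gcongr; norm_num) hYε
  have hYpos : 0 < Y := lt_of_lt_of_le (by positivity) hYε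
  have hYone : 1 ≤ Y := le_trans (by rw [le_div_iff₀ hε]; linarith) hY1
  have hlog : 0 ≤ Real.log Y := Real.log_nonneg hYone
  -- The mesh costs volume `ε / 4`, leaving grid boxes of volume at least `ε / 2`, and leaves `ε /
  -- 4` of the target for the union bound.
  have hmain := expectedDispersion_le_add (n := n) (d := d) (t := 3 * ε / 4) (h := ε / (8 * d))
    (by positivity) (by positivity)
  have hδ : 3 * ε / 4 - d * (2 * (ε / (8 * d))) = ε / 2 := by field_simp; ring
  rw [hδ] at hmain
  have hcard := card_tuplesWithSumLE_le (ι := Fin d ⊕ Fin d)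
    (M := ⌊1 / (3 * ε / 4 * (ε / (8 * d)))⌋₊) (T := 1 / (3 * ε / 4 * (ε / (8 * d))))
    (by positivity) (Nat.floor_le (by positivity))
  have hcι : Fintype.card (Fin d ⊕ Fin d) = 2 * d := by simp; ring
  rw [hcι] at hcard
  -- The dimension cancels: `T / (2 * d) = 16 / (3 * ε ^ 2)`. The count is therefore at most `Y ^ (4
  -- * d)`.
  have hbase : Real.exp 1 * (1 + 1 / (3 * ε / 4 * (ε / (8 * d))) / ((2 * d : ℕ) : ℝ)) ≤ Y ^ 2 := by
    have h1 : 1 / (3 * ε / 4 * (ε / (8 * d))) / ((2 * d : ℕ) : ℝ) = 16 / 3 / ε ^ 2 := by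
      push_cast; field_simp; norm_num
    have h2 : (33 / ε) ^ 2 ≤ Y ^ 2 := by gcongr
    have h3 : 1 ≤ 1 / ε ^ 2 := by
      rw [le_div_iff₀ (by positivity)]; nlinarith
    have h4 : (33 / ε) ^ 2 = 1089 * (1 / ε ^ 2) := by rw [div_pow]; norm_num; ring
    rw [h1]
    calc Real.exp 1 * (1 + 16 / 3 / ε ^ 2) ≤ 2.8 * (1 / ε ^ 2 + 16 / 3 * (1 / ε ^ 2)) := by
          rw [div_eq_mul_one_div (16 / 3 : ℝ)]
          gcongr
      _ ≤ Y ^ 2 := by nlinarith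
  have hcard' : ((tuplesWithSumLE (Fin d ⊕ Fin d)
      ⌊1 / (3 * ε / 4 * (ε / (8 * d)))⌋₊).card : ℝ) ≤ Real.exp (4 * d * Real.log Y) := by
    refine hcard.trans ((pow_le_pow_left₀ (by positivity) hbase _).trans_eq ?_)
    rw [← pow_mul, mul_comm (4 * (d : ℝ)), Real.exp_mul, Real.exp_log hYpos,
      ← Real.rpow_natCast]
    congr 1
    push_cast
    ring
  have hexp : Real.exp (-(n * (ε / 2))) ≤ Real.exp (-(5 * d * Real.log Y)) := by
    refine Real.exp_le_exp.2 (neg_le_neg ?_)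
    have hi : 1 / 9 ≤ Real.exp (-1) := by
      rw [Real.exp_neg, one_div]
      exact inv_anti₀ (by linarith) (by linarith)
    -- `9 * (1 + exp (-1)) ≥ 10` makes each emptiness probability at most `Y ^ (-5d)`, which beats
    -- the count by a factor `Y ^ d ≥ 4 / ε`.
    have h2 : 10 * (d / ε) * Real.log Y ≤ n := by
      refine le_trans ?_ hn
      gcongr
      linarith
    calc 5 * d * Real.log Y = 10 * (d / ε) * Real.log Y * (ε / 2) := by field_simp; ring
      _ ≤ n * (ε / 2) := by gcongr
  have hfin : Real.exp (4 * d * Real.log Y) * Real.exp (-(5 * d * Real.log Y)) ≤ ε / 4 := by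
    rw [← Real.exp_add]
    calc Real.exp (4 * d * Real.log Y + -(5 * d * Real.log Y)) ≤ Real.exp (-Real.log Y) := by
          refine Real.exp_le_exp.2 ?_
          nlinarith
      _ = Y⁻¹ := by rw [Real.exp_neg, Real.exp_log hYpos]
      _ ≤ (4 / ε)⁻¹ := inv_anti₀ (by positivity) hY1
      _ = ε / 4 := inv_div _ _
  have := mul_le_mul hcard' hexp (Real.exp_pos _).le (Real.exp_pos _).le
  linarith

/-! ### Bounds on the inverse and linear growth. -/

theorem isLeast_invExpectedDispersion {ε : ℝ} {d n : ℕ} (hn : 1 ≤ n)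
    (h : expectedDispersion n d ≤ ε) :
    IsLeast {n : ℕ | 1 ≤ n ∧ expectedDispersion n d ≤ ε} (invExpectedDispersion ε d) :=
  ⟨Nat.sInf_mem ⟨n, hn, h⟩, fun _ hm => Nat.sInf_le hm⟩

theorem max_le_of_expectedDispersion_le {ε : ℝ}
    (hε : ε ∈ Set.Ioo (0 : ℝ) (1 / (9 * Real.exp 1))) {n d : ℕ} (hd : 1 ≤ d) (hn : 1 ≤ n)
    (h : expectedDispersion n d ≤ ε) :
    max (1 / (9 * ε) * Real.log (1 / (9 * ε))) (d / (2 * Real.exp 1 * ε)) ≤ n := by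
  obtain ⟨h0, h1⟩ := hε
  have he : 1 < Real.exp 1 := by simp
  have hn' : (0 : ℝ) < n := by exact_mod_cast hn
  refine max_le ?_ ?_
  · by_contra! hlt
    have hx : 1 < 1 / (9 * ε) := by
      rw [lt_div_iff₀ (by positivity)] at h1
      rw [lt_div_iff₀ (by positivity)]
      nlinarith
    have hlow := lt_expectedDispersion_of_lt_mul_log hd hx hlt
    have : 1 / (9 * (1 / (9 * ε))) = ε := by field_simp
    linarith
  · rcases le_total d n with hdn | hnd
    · have h2 := (div_le_expectedDispersion hd hdn).trans h
      rw [div_le_iff₀ (by positivity)] at h2 ⊢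
      linarith
    -- The case `n ≤ d` is impossible: the expected dispersion would be at least `exp (-1) > ε`.
    · have h2 := (exp_neg_one_le_expectedDispersion hd hnd).trans h
      have h3 : 1 / (9 * Real.exp 1) ≤ Real.exp (-1) := by
        rw [Real.exp_neg, ← one_div]
        exact one_div_le_one_div_of_le (by positivity) (by linarith)
      linarith

theorem isTheta_natCast_of_le_of_le {f : ℕ → ℕ} {c C : ℝ} (hc : 0 < c)
    (hlow : ∀ d, 1 ≤ d → c * d ≤ f d) (hup : ∀ d, 1 ≤ d → f d ≤ ⌈C * (d : ℝ)⌉₊) :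
    (fun d : ℕ => (f d : ℝ)) =Θ[Filter.atTop] fun d : ℕ => (d : ℝ) := by
  constructor
  · refine IsBigO.of_bound (|C| + 1) (Filter.eventually_atTop.2 ⟨1, fun d hd => ?_⟩)
    have hd' : (1 : ℝ) ≤ d := by exact_mod_cast hd
    rw [Real.norm_natCast, Real.norm_natCast]
    have h1 : (f d : ℝ) ≤ ⌈|C| * (d : ℝ)⌉₊ := by
      exact_mod_cast (hup d hd).trans (Nat.ceil_mono (by gcongr; exact le_abs_self C))
    -- The `+ 1` from the ceiling is absorbed into the constant because `1 ≤ d`.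
    linarith [Nat.ceil_lt_add_one (by positivity : 0 ≤ |C| * (d : ℝ))]
  · refine IsBigO.of_bound c⁻¹ (Filter.eventually_atTop.2 ⟨1, fun d hd => ?_⟩)
    rw [Real.norm_natCast, Real.norm_natCast, inv_mul_eq_div, le_div_iff₀ hc, mul_comm]
    exact hlow d hd

theorem corollary1 (ε : ℝ) (hε : ε ∈ Set.Ioo (0 : ℝ) (1 / (9 * Real.exp 1))) :
    (∀ d : ℕ, 1 ≤ d →
      -- the minimum defining `N(ε,d)` is attained, and it is the same for every i.i.d. uniform
      -- sequence on every probability space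
      (∀ (Ω : Type*) [MeasurableSpace Ω] (P : Measure Ω) [IsProbabilityMeasure P]
          (X : ℕ → Ω → Fin d → ℝ),
          iIndepFun X P → (∀ i, HasLaw (X i) (uniformCube d) P) →
          (∀ n : ℕ, Integrable (fun ω => dispersion fun i : Fin n => X i ω) P) ∧
          IsLeast {n : ℕ | 1 ≤ n ∧ ∫ ω, dispersion (fun i : Fin n => X i ω) ∂P ≤ ε}
            (invExpectedDispersion ε d)) ∧
      max (1 / (9 * ε) * Real.log (1 / (9 * ε))) (d / (2 * Real.exp 1 * ε))
        ≤ (invExpectedDispersion ε d : ℝ) ∧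
      invExpectedDispersion ε d
        ≤ ⌈9 * (1 + Real.exp (-1)) * (d / ε) * Real.log (9 * (Real.exp 1 + 1) / ε)⌉₊) ∧
    -- linear growth in the dimension
    (fun d : ℕ => (invExpectedDispersion ε d : ℝ)) =Θ[Filter.atTop] (fun d : ℕ => (d : ℝ)) := by
  have h0 : 0 < ε := hε.1
  have he : 1 < Real.exp 1 := by simp
  have h9 : ε ≤ 1 / 9 := hε.2.le.trans
    (one_div_le_one_div_of_le (by norm_num) (by linarith))
  have hYone : 1 < 9 * (Real.exp 1 + 1) / ε := by
    rw [lt_div_iff₀ h0]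
    linarith
  have hlogpos := Real.log_pos hYone
  have hceil : ∀ d : ℕ, 1 ≤ d →
      1 ≤ ⌈9 * (1 + Real.exp (-1)) * (d / ε) * Real.log (9 * (Real.exp 1 + 1) / ε)⌉₊ := by
    intro d hd
    have : (0 : ℝ) < d := by exact_mod_cast hd
    exact Nat.ceil_pos.2 (by positivity)
  have hupper : ∀ d : ℕ, 1 ≤ d → expectedDispersion
      ⌈9 * (1 + Real.exp (-1)) * (d / ε) * Real.log (9 * (Real.exp 1 + 1) / ε)⌉₊ d ≤ ε :=
    fun d hd => expectedDispersion_le_of_mul_log_le hd h0 h9 (Nat.le_ceil _)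
  have hleast := fun d hd => isLeast_invExpectedDispersion (hceil d hd) (hupper d hd)
  have hlow := fun d hd =>
    max_le_of_expectedDispersion_le hε hd (hleast d hd).1.1 (hleast d hd).1.2
  have hup := fun d hd => (hleast d hd).2 ⟨hceil d hd, hupper d hd⟩
  refine ⟨fun d hd => ⟨fun Ω _ P _ X hX hlaw => ⟨integrable_dispersion_of_iIndepFun hX hlaw, ?_⟩,
    hlow d hd, hup d hd⟩, ?_⟩
  · simp only [integral_dispersion_of_iIndepFun hX hlaw]
    exact hleast d hd
  · refine isTheta_natCast_of_le_of_le (c := 1 / (2 * Real.exp 1 * ε))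
      (C := 9 * (1 + Real.exp (-1)) / ε * Real.log (9 * (Real.exp 1 + 1) / ε))
      (by positivity) (fun d hd => ?_) fun d hd => (hup d hd).trans (Nat.ceil_mono (le_of_eq ?_))
    · rw [one_div_mul_eq_div]
      exact (le_max_right _ _).trans (hlow d hd)
    · ring
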